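/- Let $k$ be a field and $G$ a finite group. For a $k$-algebra $A$ with $\overline A=A/k\cdot 1$, let $C^n(A)=\mathrm{Hom}_k(\overline A^{\otimes n},A)$ (the $k$-multilinear maps $A^n\to A$ that vanish when some argument is $1$) be the normalized Hochschild cochains, with $$\delta(f)(a_1,\dots,a_{n+1})=a_1f(a_2,\dots,a_{n+1})+\sum_{i=1}^n(-1)^if(a_1,\dots,a_ia_{i+1},\dots,a_{n+1})+(-1)^{n+1}f(a_1,\dots,a_n)a_{n+1},$$ and let $HH^n(A)=H^n(C^*(A),\delta)$. This is the complex obtained by applying $\mathrm{Hom}_{A\otimes A^{op}}(-,A)$ to the normalized bar resolution of $A$. For $A=kG$, a cochain is the same as a map $\varphi:\overline G^{\times n}\to kG$, where $\overline G=G\setminus\{1\}$; it is extended by $0$ to tuples with an entry equal to $1$. For a group $H$, let $H^n(H,k)$ be the $n$-th cohomology of the complex of maps $f:\overline H^{\times n}\to k$ (extended by $0$ to $H^n$), obtained from the normalized bar resolution of the trivial module, with $$\delta(f)(h_1,\dots,h_{n+1})=f(h_2,\dots,h_{n+1})+\sum_{i=1}^n(-1)^if(h_1,\dots,h_ih_{i+1},\dots,h_{n+1})+(-1)^{n+1}f(h_1,\dots,h_n).$$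 Let $X\subseteq G$ be a set of representatives of the conjugacy classes of $G$. For $x\in X$ let $C_G(x)$ be the centralizer of $x$, and choose a right transversal $S_x=\{\gamma_{1,x},\dots,\gamma_{n_x,x}\}$ of $C_G(x)$ in $G$, so that $G=\bigsqcup_i C_G(x)\gamma_{i,x}$, with $\gamma_{1,x}=1$. Put $x_i=\gamma_{i,x}^{-1}x\gamma_{i,x}$. Then for every $n\ge 0$ there is an isomorphism of $k$-vector spaces $$HH^n(kG)\;\xrightarrow{\ \sim\ }\;\bigoplus_{x\in X}H^n(C_G(x),k)$$ (hence an isomorphism of graded vector spaces $HH^*(kG)\cong\bigoplus_{x\in X}H^*(C_G(x),k)$) given on classes of cocycles as follows. 1. The class of a cocycle $\varphi:\overline G^{\times n}\to kG$ is sent to $\bigoplus_{x}[\widehat\varphi_x]$, where $\widehat\varphi_x(h_1,\dots,h_n)$, for $h_1,\dots,h_n\in C_G(x)$, is the coefficient of $x$ in $$(-1)^{\frac{n(n+1)}2}\,h_1\cdots h_n\,\varphi(h_n^{-1},\dots,h_1^{-1})\in kG;$$ in particular each $\widehat\varphi_x$ is a cocycle. 2. The inverse sends $\bigoplus_x[f_x]$,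 for cocycles $f_x:\overline{C_G(x)}^{\times n}\to k$ $(x\in X)$, to the class of the cocycle $\varphi$ given by $$\varphi(g_1,\dots,g_n)=(-1)^{\frac{n(n+1)}2}\,g_1\cdots g_n\sum_{x\in X}\sum_{i=1}^{n_x}f_x(h'_{i,1},\dots,h'_{i,n})\,x_i,$$ where, for each $x$ and $i$, the elements $h'_{i,1},\dots,h'_{i,n}\in C_G(x)$ and $\gamma_{s_i^1,x},\dots,\gamma_{s_i^n,x}\in S_x$ are determined successively by $$\gamma_{i,x}g_n^{-1}=h'_{i,1}\gamma_{s_i^1,x},\quad \gamma_{s_i^1,x}g_{n-1}^{-1}=h'_{i,2}\gamma_{s_i^2,x},\quad\dots,\quad \gamma_{s_i^{n-1},x}g_1^{-1}=h'_{i,n}\gamma_{s_i^n,x}.$$ -/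

import Mathlib

open scoped DirectSum

namespace GroupHochschild

noncomputable section

/-! ### Cohomology of the subcomplex of normalized cochains

`N n` is the space of normalized `n`-cochains inside all `n`-cochains `C n`, with differential
`δ n : C n → C (n + 1)`; the cohomology is that of the complex of normalized cochains. -/

section Cohomology

variable {k : Type*} [Ring k] {C : ℕ → Type*} [∀ n, AddCommGroup (C n)] [∀ n, Module k (C n)]

/-- The `n`-cocycles that lie in `N n`. -/
def cocycles (N : ∀ n, Submodule k (C n)) (δ : ∀ n, C n →ₗ[k] C (n + 1)) (n : ℕ) :
    Submodule k (C n) :=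
  N n ⊓ LinearMap.ker (δ n)

/-- The coboundaries of cochains that lie in `N`. -/
def coboundaries (N : ∀ n, Submodule k (C n)) (δ : ∀ n, C n →ₗ[k] C (n + 1)) :
    ∀ n, Submodule k (C n)
  | 0 => ⊥
  | n + 1 => (N n).map (δ n)

/-- Cocycles modulo coboundaries. -/
abbrev Cohomology (N : ∀ n, Submodule k (C n)) (δ : ∀ n, C n →ₗ[k] C (n + 1)) (n : ℕ) :=
  cocycles N δ n ⧸ (coboundaries N δ n).submoduleOf (cocycles N δ n)

end Cohomology

/-! ### Normalized Hochschild cohomology of an algebra with coefficients in itself -/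

section Hochschild

variable (k : Type*) [Field k] (A : Type*) [Ring A] [Algebra k A]

/-- All `k`-multilinear maps `A ^ n → A`. -/
abbrev HochCochain (n : ℕ) := MultilinearMap k (fun _ : Fin n => A) A

/-- Normalized cochains: the multilinear maps that vanish as soon as one argument is `1`, that is,
those which factor through the tensor power of `A ⧸ k · 1`. -/
def hochNormalized (n : ℕ) : Submodule k (HochCochain k A n) where
  carrier := {f | ∀ a : Fin n → A, (∃ i, a i = 1) → f a = 0}
  add_mem' hf hg a ha := by simp [hf a ha, hg a ha]
  zero_mem' _ _ := rfl
  smul_mem' c f hf a ha := by simp [hf a ha]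

variable {k A}

/-- Multiplying two neighbours is linear in each entry separately. -/
theorem contractNth_update {n : ℕ} (i : Fin n) (j : Fin (n + 1)) (a : Fin (n + 1) → A) :
    ∃ (j' : Fin n) (L : A →ₗ[k] A), ∀ v,
      Fin.contractNth i.castSucc (· * ·) (Function.update a j v) =
        Function.update (Fin.contractNth i.castSucc (· * ·) a) j' (L v) := by
  rcases lt_trichotomy j.val i.val with h | h | h
  · refine ⟨⟨j, by omega⟩, LinearMap.id, fun v => ?_⟩
    ext l
    simp only [Fin.contractNth, Function.update_apply, Fin.ext_iff, Fin.val_castSucc,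
      Fin.val_succ, LinearMap.id_apply]
    split_ifs <;> first | rfl | omega
  · refine ⟨i, LinearMap.mulRight k (a i.succ), fun v => ?_⟩
    ext l
    simp only [Fin.contractNth, Function.update_apply, Fin.ext_iff, Fin.val_castSucc,
      Fin.val_succ, LinearMap.mulRight_apply]
    split_ifs with h1 h2 h3 h4 <;> first | rfl | omega | skip
    have : l = i := by apply Fin.ext; omega
    rw [this]
  · by_cases h' : j.val = i.val + 1
    · refine ⟨i, LinearMap.mulLeft k (a i.castSucc), fun v => ?_⟩
      ext l
      simp only [Fin.contractNth, Function.update_apply, Fin.ext_iff, Fin.val_castSucc,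
        Fin.val_succ, LinearMap.mulLeft_apply]
      split_ifs with h1 h2 h3 h4 <;> first | rfl | omega | skip
      have : l = i := by apply Fin.ext; omega
      rw [this]
    · refine ⟨⟨j - 1, by omega⟩, LinearMap.id, fun v => ?_⟩
      ext l
      simp only [Fin.contractNth, Function.update_apply, Fin.ext_iff, Fin.val_castSucc,
        Fin.val_succ, LinearMap.id_apply]
      split_ifs <;> first | rfl | omega

/-- The cochain `(a₁, …, aₙ₊₁) ↦ f (a₁, …, aᵢ aᵢ₊₁, …, aₙ₊₁)` (with `i` counted from zero). -/
def hochContract {n : ℕ} (i : Fin n) (f : HochCochain k A n) : HochCochain k A (n + 1) where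
  toFun a := f (Fin.contractNth i.castSucc (· * ·) a)
  map_update_add' {inst} a j x y := by
    obtain rfl : inst = instDecidableEqFin (n + 1) := Subsingleton.elim _ _
    obtain ⟨j', L, h⟩ := contractNth_update (k := k) i j a
    simp [h]
  map_update_smul' {inst} a j c x := by
    obtain rfl : inst = instDecidableEqFin (n + 1) := Subsingleton.elim _ _
    obtain ⟨j', L, h⟩ := contractNth_update (k := k) i j a
    simp [h]

/-- The cochain `(a₁, …, aₙ₊₁) ↦ a₁ f (a₂, …, aₙ₊₁)`. -/
def hochLeft {n : ℕ} (f : HochCochain k A n) : HochCochain k A (n + 1) :=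
  LinearMap.uncurryLeft (M := fun _ : Fin (n + 1) => A)
    { toFun := fun b => (LinearMap.mulLeft k b).compMultilinearMap f
      map_add' := fun b c => by ext a; simp [add_mul]
      map_smul' := fun r b => by ext a; simp }

/-- The cochain `(a₁, …, aₙ₊₁) ↦ f (a₁, …, aₙ) aₙ₊₁`. -/
def hochRight {n : ℕ} (f : HochCochain k A n) : HochCochain k A (n + 1) :=
  MultilinearMap.uncurryRight (M := fun _ : Fin (n + 1) => A)
    ((LinearMap.mul k A).compMultilinearMap f)

variable (k A) in
/-- The Hochschild differential. -/
def hochDifferential (n : ℕ) : HochCochain k A n →ₗ[k] HochCochain k A (n + 1) where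
  toFun f := hochLeft f + ∑ i : Fin n, (-1 : k) ^ (i.val + 1) • hochContract i f +
    (-1 : k) ^ (n + 1) • hochRight f
  map_add' f g := by
    ext a
    simp [hochLeft, hochContract, hochRight, Finset.sum_add_distrib]
    abel
  map_smul' r f := by
    ext a
    simp [hochLeft, hochContract, hochRight, smul_add, Finset.smul_sum, smul_comm _ r]

/-- The explicit form of the Hochschild differential. -/
theorem hochDifferential_apply (n : ℕ) (f : HochCochain k A n) (a : Fin (n + 1) → A) :
    hochDifferential k A n f a = a 0 * f (Fin.tail a) +
      ∑ i : Fin n, (-1 : k) ^ (i.val + 1) • f (Fin.contractNth i.castSucc (· * ·) a) +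
      (-1 : k) ^ (n + 1) • (f (Fin.init a) * a (Fin.last n)) := by
  simp [hochDifferential, hochLeft, hochContract, hochRight]

variable (k A)

/-- Normalized Hochschild `n`-cocycles of `A`. -/
abbrev HochCocycles (n : ℕ) : Submodule k (HochCochain k A n) :=
  cocycles (hochNormalized k A) (hochDifferential k A) n

/-- `HHⁿ(A)`, computed by normalized Hochschild cochains. -/
abbrev HH (n : ℕ) := Cohomology (hochNormalized k A) (hochDifferential k A) n

variable {k A} in
/-- The class in `HHⁿ(A)` of a normalized cocycle. -/
def HH.mk {n : ℕ} (φ : HochCocycles k A n) : HH k A n := Submodule.Quotient.mk φ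

end Hochschild

/-! ### Normalized group cohomology -/

section GroupCohomology

variable {k : Type*} [Field k] {H : Type*} [Group H] {U : Type*} [AddCommGroup U] [Module k U]

variable (k H U) in
/-- Normalized inhomogeneous cochains: maps `Hⁿ → U` that vanish on the tuples with an entry `1`,
that is, maps `(H ∖ {1})ⁿ → U` extended by zero. -/
def grpNormalized (n : ℕ) : Submodule k ((Fin n → H) → U) where
  carrier := {f | ∀ h : Fin n → H, (∃ i, h i = 1) → f h = 0}
  add_mem' hf hg a ha := by simp [hf a ha, hg a ha]
  zero_mem' _ _ := rfl
  smul_mem' c f hf a ha := by simp [hf a ha]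

/-- The differential on inhomogeneous cochains with coefficients in a representation. -/
def grpDifferential (ρ : Representation k H U) (n : ℕ) :
    ((Fin n → H) → U) →ₗ[k] ((Fin (n + 1) → H) → U) where
  toFun f h := ρ (h 0) (f (Fin.tail h)) +
    ∑ i : Fin n, (-1 : k) ^ (i.val + 1) • f (Fin.contractNth i.castSucc (· * ·) h) +
    (-1 : k) ^ (n + 1) • f (Fin.init h)
  map_add' f g := by
    ext h
    simp [Finset.sum_add_distrib]
    abel
  map_smul' r f := by
    ext h
    simp [smul_add, Finset.smul_sum, smul_comm _ r]

variable (k H)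

/-- Normalized `n`-cocycles of `H` with coefficients in the trivial module `k`. -/
abbrev GrpCocycles (n : ℕ) : Submodule k ((Fin n → H) → k) :=
  cocycles (grpNormalized k H k) (grpDifferential (Representation.trivial k H k)) n

/-- `Hⁿ(H, k)` with trivial coefficients, computed by normalized cochains. -/
abbrev GrpCohomology (n : ℕ) :=
  Cohomology (grpNormalized k H k) (grpDifferential (Representation.trivial k H k)) n

variable {k H} in
/-- The class in `Hⁿ(H, k)` of a normalized cocycle. -/
def GrpCohomology.mk {n : ℕ} (f : GrpCocycles k H n) : GrpCohomology k H n :=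
  Submodule.Quotient.mk f

end GroupCohomology

/-! ### Walking through a right transversal -/

section Transversal

variable {G : Type*} [Group G] {C : Subgroup G} {S : Finset G}

/-- For `G = ⨆ C γ` (`γ ∈ S`), the elements `γ⁰ = γ, γ¹, …, γⁿ` of `S` with
`γʲ⁻¹ gⱼ ∈ C γʲ` for all `j`. -/
def cosetPath (hS : Subgroup.IsComplement (C : Set G) (S : Set G)) (γ : (S : Set G)) {n : ℕ}
    (g : Fin n → G) : Fin (n + 1) → (S : Set G) :=
  Fin.induction γ fun j s => (hS.equiv ((s : G) * g j)).2

/-- The elements `h₁, …, hₙ` of `C` with `γʲ⁻¹ gⱼ = hⱼ γʲ`, where `γ⁰ = γ, γ¹, …, γⁿ` is the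
path in `S` that `g` determines. -/
def cosetFactor (hS : Subgroup.IsComplement (C : Set G) (S : Set G)) (γ : (S : Set G)) {n : ℕ}
    (g : Fin n → G) (j : Fin n) : C :=
  (hS.equiv ((cosetPath hS γ g j.castSucc : G) * g j)).1

/-- The defining recursion of `cosetPath` and `cosetFactor`. -/
theorem cosetPath_mul (hS : Subgroup.IsComplement (C : Set G) (S : Set G)) (γ : (S : Set G))
    {n : ℕ} (g : Fin n → G) :
    cosetPath hS γ g 0 = γ ∧ ∀ j : Fin n, (cosetPath hS γ g j.castSucc : G) * g j =
      (cosetFactor hS γ g j : G) * (cosetPath hS γ g j.succ : G) := by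
  refine ⟨rfl, fun j => ?_⟩
  exact (hS.equiv_fst_mul_equiv_snd _).symm

end Transversal

/-! ### The two cochain formulas -/

section Formulas

variable {k : Type*} [Field k] {G : Type*} [Group G]

/-- The ordered product `g₁ ⋯ gₙ`. -/
def tupleProd {n : ℕ} (g : Fin n → G) : G := (List.ofFn g).prod

/-- `(gₙ⁻¹, …, g₁⁻¹)`. -/
def revInv {n : ℕ} (g : Fin n → G) : Fin n → G := fun j => (g j.rev)⁻¹

/-- The element `(-1)^(n(n+1)/2) g₁ ⋯ gₙ m` of `kG`. -/
def signedTranslate {n : ℕ} (g : Fin n → G) (m : MonoidAlgebra k G) : MonoidAlgebra k G :=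
  (-1 : k) ^ (n * (n + 1) / 2) • (MonoidAlgebra.of k G (tupleProd g) * m)

/-- `φ̂ₓ (h₁, …, hₙ)`: the coefficient of `x` in
`(-1)^(n(n+1)/2) h₁ ⋯ hₙ φ(hₙ⁻¹, …, h₁⁻¹)`, for `h₁, …, hₙ` in the centralizer of `x`. -/
def hat {n : ℕ} (φ : HochCochain k (MonoidAlgebra k G) n) (x : G)
    (h : Fin n → Subgroup.centralizer {x}) : k :=
  (signedTranslate (fun j => (h j : G))
    (φ fun j => MonoidAlgebra.of k G (revInv (fun i => (h i : G)) j))).coeff x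

/-- `(-1)^(n(n+1)/2) g₁ ⋯ gₙ ∑ₓ ∑_γ fₓ(h'₁, …, h'ₙ) γ⁻¹xγ`, where `γ` runs over the transversal of
the centralizer of `x` and `h'₁, …, h'ₙ` are determined by `γ` and `(gₙ⁻¹, …, g₁⁻¹)`. -/
def unhat {X : Finset G} {S : X → Finset G}
    (hS : ∀ x : X, Subgroup.IsComplement
      (Subgroup.centralizer {(x : G)} : Set G) (S x : Set G))
    {n : ℕ} (f : ∀ x : X, (Fin n → Subgroup.centralizer {(x : G)}) → k) (g : Fin n → G) :
    MonoidAlgebra k G :=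
  signedTranslate g (∑ x : X, ∑ γ : (S x : Set G),
    f x (cosetFactor (hS x) γ (revInv g)) •
      MonoidAlgebra.of k G ((γ : G)⁻¹ * (x : G) * (γ : G)))

end Formulas

end

end GroupHochschild

/-! Write a tuple in `G` as the successive quotients of vertices `w₀, …, wₙ`. For fixed `x`, the
coefficient of `w₀⁻¹xwₙ` in `φ(w₀⁻¹w₁, …, wₙ₋₁⁻¹wₙ)` is a function of the vertices that is invariant
under left multiplication by `C_G(x)`. As `x` runs over `X`, these functions determine `φ`, and
every family of such invariant functions occurs (`cyclicCoeff_ext`, `vertexCoeff_assemble`). The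
Hochschild differential becomes the alternating sum over faces, and normalized means vanishing when
two consecutive vertices agree. Reversing the vertices, with the sign `(-1)^(n(n+1)/2)`, yields
`vertexCoeff`.

In this model `hat` restricts to vertices in `C_G(x)`, and `unhat` pulls back along the equivariant
projection `cγ ↦ c` of `G` onto `C_G(x)`. The projection fixes `C_G(x)` because `1 ∈ S x`, so `hat`
after `unhat` is the identity on cochains (`hat_unhatCochain`). The other composite replaces `v` by
its projection, which is homotopic to the identity by the prism operator (`sum_vertexCoeff_prism`).
So a cocycle whose components are all coboundaries is itself a coboundary
(`mem_coboundaries_of_hat`). -/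

namespace GroupHochschild

noncomputable section

/-! ### Sequences of vertices -/

section Vertices

/-- The sequence `v` without its `i`-th vertex. -/
def face {α : Type*} (i : ℕ) (v : ℕ → α) (l : ℕ) : α := if l < i then v l else v (l + 1)

/-- The tuple `(v₀⁻¹v₁, …, vₙ₋₁⁻¹vₙ)` of successive quotients. -/
def quotients {H : Type*} [Group H] (n : ℕ) (v : ℕ → H) : Fin n → H :=
  fun i => (v i)⁻¹ * v (i + 1)

/-- The vertices `γ, γg₁, γg₁g₂, …`. -/
def vertices {H : Type*} [Group H] (γ : H) {n : ℕ} (g : Fin n → H) (l : ℕ) : H :=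
  γ * ((List.ofFn g).take l).prod

variable {H : Type*} [Group H]

/-- Indexing vertices by all of `ℕ` keeps faces and prisms free of casts; the price is to record
that only `v 0, …, v n` matter. -/
theorem quotients_congr {n : ℕ} {v w : ℕ → H} (h : ∀ l ≤ n, v l = w l) :
    quotients n v = quotients n w := by
  ext i
  simp only [quotients]
  rw [h i (by omega), h (i + 1) (by omega)]

theorem quotients_mul_left (n : ℕ) (z : H) (v : ℕ → H) :
    quotients n (fun l => z * v l) = quotients n v := by
  ext i
  simp only [quotients]
  group

@[simp]
theorem vertices_zero (γ : H) {n : ℕ} (g : Fin n → H) : vertices γ g 0 = γ := by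
  simp [vertices]

theorem vertices_succ (γ : H) {n : ℕ} (g : Fin n → H) (i : Fin n) :
    vertices γ g (i + 1) = vertices γ g i * g i := by
  rw [vertices, vertices, List.prod_take_succ _ _ (by simp), mul_assoc]
  simp

@[simp]
theorem quotients_vertices (γ : H) {n : ℕ} (g : Fin n → H) : quotients n (vertices γ g) = g := by
  ext i
  rw [quotients, vertices_succ, inv_mul_cancel_left]

theorem vertices_last (γ : H) {n : ℕ} (g : Fin n → H) : vertices γ g n = γ * tupleProd g := by
  rw [vertices, tupleProd, List.take_of_length_le (by simp)]

/-- The base point `γ` is free, so that a left translation can move the start of a sequence into a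
transversal. -/
theorem eq_mul_vertices_quotients {n : ℕ} (v : ℕ → H) (γ : H) {l : ℕ} (hl : l ≤ n) :
    v l = v 0 * γ⁻¹ * vertices γ (quotients n v) l := by
  induction l with
  | zero => simp
  | succ l ih =>
    rw [vertices_succ γ (quotients n v) ⟨l, hl⟩, ← mul_assoc, ← ih (by omega)]
    simp [quotients]

theorem tupleProd_quotients (n : ℕ) (v : ℕ → H) :
    tupleProd (quotients n v) = (v 0)⁻¹ * v n := by
  have h := eq_mul_vertices_quotients v 1 (le_refl n)
  rw [vertices_last] at h
  rw [h]
  group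

theorem quotients_face_zero (n : ℕ) (v : ℕ → H) :
    quotients n (face 0 v) = Fin.tail (quotients (n + 1) v) := by
  ext i
  simp [quotients, face, Fin.tail]

/-- Deleting an inner vertex merges two quotients: `(a⁻¹b)(b⁻¹c) = a⁻¹c`. -/
theorem quotients_face_succ {n : ℕ} (i : Fin n) (v : ℕ → H) :
    quotients n (face (i + 1) v) =
      Fin.contractNth i.castSucc (· * ·) (quotients (n + 1) v) := by
  ext j
  simp only [quotients, face, Fin.contractNth, Fin.val_castSucc, Fin.val_succ]
  rcases lt_trichotomy j.val i.val with h | h | h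
  · simp [h, show j.val < i.val + 1 by omega]
  · simp [h, mul_assoc]
  · simp [show ¬ j.val < i.val by omega, show ¬ j.val < i.val + 1 by omega,
      show j.val ≠ i.val by omega]

theorem quotients_face_last (n : ℕ) (v : ℕ → H) :
    quotients n (face (n + 1) v) = Fin.init (quotients (n + 1) v) := by
  ext i
  simp [quotients, face, Fin.init, show i.val < n + 1 by omega]

/-- Reading the vertices backwards is what produces the arguments `gₙ⁻¹, …, g₁⁻¹`. -/
theorem revInv_quotients (n : ℕ) (v : ℕ → H) :
    revInv (quotients n fun l => v (n - l)) = quotients n v := by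
  ext i
  simp only [revInv, quotients, Fin.val_rev, mul_inv_rev, inv_inv]
  congr 3 <;> omega

theorem quotients_reverse (n : ℕ) (v : ℕ → H) :
    quotients n (fun l => v (n - l)) = revInv (quotients n v) := by
  rw [← revInv_quotients n (fun l => v (n - l))]
  congr 1
  refine quotients_congr fun l hl => ?_
  rw [show n - (n - l) = l by omega]

theorem quotients_eq_one_iff {n : ℕ} (v : ℕ → H) (i : Fin n) :
    quotients n v i = 1 ↔ v i = v (i + 1) := by
  rw [quotients, inv_mul_eq_one]

/-- The alternating sum over all faces, separating the two outer ones. -/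
theorem sum_range_faces {M : Type*} [AddCommMonoid M] (n : ℕ) (a : ℕ → M) :
    ∑ i ∈ Finset.range (n + 2), a i = a 0 + ∑ i : Fin n, a (i + 1) + a (n + 1) := by
  rw [Finset.sum_range_succ, Finset.sum_range_succ', Finset.sum_range (fun i => a (i + 1)),
    add_comm (∑ i : Fin n, a (i + 1))]

/-- The differential for trivial coefficients is the alternating sum over the faces. -/
theorem grpDifferential_trivial_quotients {k : Type*} [Field k] {n : ℕ} (f : (Fin n → H) → k)
    (v : ℕ → H) :
    grpDifferential (Representation.trivial k H k) n f (quotients (n + 1) v) =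
      ∑ i ∈ Finset.range (n + 2), (-1 : k) ^ i * f (quotients n (face i v)) := by
  rw [sum_range_faces]
  simp [grpDifferential, quotients_face_zero, quotients_face_succ, quotients_face_last]

end Vertices

/-! ### The prism -/

section Prism

/-- In the `j`-th prism simplex the faces `j` and `j + 1` are inner and telescope; the others belong
to prisms over faces, with indices shifted on one side of the diagonal. -/
theorem sum_range_split_diagonal {M : Type*} [AddCommMonoid M] {j m : ℕ} (hj : j ≤ m)
    (F : ℕ → M) :
    ∑ i ∈ Finset.range (m + 2), F i =
      ∑ i ∈ Finset.range (m + 1), (if i < j then F i else 0) + F j + F (j + 1) +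
        ∑ i ∈ Finset.range (m + 1), (if j < i then F (i + 1) else 0) := by
  induction m, hj using Nat.le_induction with
  | base =>
    rw [Finset.sum_range_succ, Finset.sum_range_succ,
      Finset.sum_range_succ (fun i => if i < j then F i else 0)]
    rw [Finset.sum_congr rfl fun i hi => if_pos (Finset.mem_range.1 hi),
      Finset.sum_eq_zero (s := Finset.range (j + 1)) fun i hi =>
        if_neg (by have := Finset.mem_range.1 hi; omega)]
    simp
  | succ m hm ih =>
    rw [Finset.sum_range_succ, ih, Finset.sum_range_succ _ (m + 1),
      Finset.sum_range_succ _ (m + 1), if_neg (by omega), if_pos (by omega)]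
    simp [add_assoc]

/-- If the faces `T j i` of the `j`-th simplex of a prism are, apart from the inner faces `D`,
the simplices `U` of the prisms over the faces, then the alternating sum telescopes. -/
theorem prism_sum {R : Type*} [CommRing R] (m : ℕ) (T U : ℕ → ℕ → R) (D : ℕ → R)
    (hlt : ∀ j i, i ≤ j → T (j + 1) i = U j i) (hgt : ∀ j i, j < i → T j (i + 1) = U j i)
    (hD : ∀ j, T j j = D j) (hD' : ∀ j, T j (j + 1) = D (j + 1)) :
    ∑ j ∈ Finset.range (m + 1), ∑ i ∈ Finset.range (m + 2), (-1) ^ (j + i) * T j i =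
      D 0 - D (m + 1) -
        ∑ j ∈ Finset.range m, ∑ i ∈ Finset.range (m + 1), (-1) ^ (j + i) * U j i := by
  -- The two inner faces carry the signs `(-1)^(2j)` and `(-1)^(2j+1)`, hence contribute `D j - D (j
  -- + 1)`.
  have key : ∀ j ∈ Finset.range (m + 1),
      ∑ i ∈ Finset.range (m + 2), (-1) ^ (j + i) * T j i =
        ∑ i ∈ Finset.range (m + 1), (if i < j then (-1) ^ (j + i) * T j i else 0) +
        (D j - D (j + 1)) +
        ∑ i ∈ Finset.range (m + 1), (if j < i then (-1) ^ (j + (i + 1)) * T j (i + 1) else 0) := by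
    intro j hj
    rw [sum_range_split_diagonal (Nat.lt_succ_iff.1 (Finset.mem_range.1 hj)), hD, hD', ← add_assoc,
      pow_succ, Even.neg_one_pow ⟨j, rfl⟩]
    ring
  rw [Finset.sum_congr rfl key, Finset.sum_add_distrib, Finset.sum_add_distrib,
    Finset.sum_range_sub' D, Finset.sum_range_succ', Finset.sum_range_succ
      (fun j => ∑ i ∈ Finset.range (m + 1),
        if j < i then (-1) ^ (j + (i + 1)) * T j (i + 1) else 0)]
  have h0 : ∑ i ∈ Finset.range (m + 1), (if i < 0 then (-1) ^ (0 + i) * T 0 i else 0) = 0 :=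
    Finset.sum_eq_zero fun i _ => if_neg (by omega)
  have hm : ∑ i ∈ Finset.range (m + 1),
      (if m < i then (-1) ^ (m + (i + 1)) * T m (i + 1) else 0) = 0 :=
    Finset.sum_eq_zero fun i hi => if_neg (by have := Finset.mem_range.1 hi; omega)
  -- Either identification of `U j i` with a face of a prism simplex raises exactly one index by
  -- one, so the sign flips.
  have hU : ∑ j ∈ Finset.range m, ∑ i ∈ Finset.range (m + 1), (-1) ^ (j + i) * U j i =
      -(∑ j ∈ Finset.range m, ∑ i ∈ Finset.range (m + 1),
        (if i < j + 1 then (-1) ^ (j + 1 + i) * T (j + 1) i else 0)) -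
      ∑ j ∈ Finset.range m, ∑ i ∈ Finset.range (m + 1),
        (if j < i then (-1) ^ (j + (i + 1)) * T j (i + 1) else 0) := by
    rw [← Finset.sum_neg_distrib, ← Finset.sum_sub_distrib]
    refine Finset.sum_congr rfl fun j _ => ?_
    rw [← Finset.sum_neg_distrib, ← Finset.sum_sub_distrib]
    refine Finset.sum_congr rfl fun i _ => ?_
    by_cases h : i ≤ j
    · rw [if_pos (by omega), if_neg (by omega), hlt j i h]
      ring
    · rw [if_neg (by omega), if_pos (by omega), hgt j i (by omega)]
      ring
  rw [h0, hm, hU]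
  ring

/-- The `j`-th simplex of the prism between `c ∘ v` and `v`. -/
def prism {α : Type*} (c : α → α) (j : ℕ) (v : ℕ → α) (l : ℕ) : α :=
  if l ≤ j then c (v l) else v (l - 1)

variable {α : Type*} (c : α → α) (v : ℕ → α)

theorem face_prism_of_le {i j : ℕ} (h : i ≤ j) :
    face i (prism c (j + 1) v) = prism c j (face i v) := by
  ext l
  simp only [face, prism]
  split_ifs <;> first | rfl | omega | skip
  rw [show l + 1 - 1 = l - 1 + 1 by omega]

theorem face_prism_of_lt {i j : ℕ} (h : j < i) :
    face (i + 1) (prism c j v) = prism c j (face i v) := by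
  ext l
  simp only [face, prism]
  split_ifs <;> first | rfl | omega | skip
  rw [show l + 1 - 1 = l - 1 + 1 by omega]

theorem face_prism_self (j : ℕ) :
    face j (prism c j v) = fun l => if l < j then c (v l) else v l := by
  ext l
  simp only [face, prism]
  split_ifs <;> first | rfl | omega

theorem face_prism_succ (j : ℕ) :
    face (j + 1) (prism c j v) = fun l => if l < j + 1 then c (v l) else v l := by
  ext l
  simp only [face, prism]
  split_ifs <;> first | rfl | omega

end Prism

/-! ### Hochschild cochains of a group algebra as functions of vertices -/

section Hochschild

variable {k : Type*} [Field k] {G : Type*} [Group G]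

/-! ### Restriction of multilinear cochains to the basis `G`. -/

/-- The values of a Hochschild cochain on tuples of group elements. -/
def onGroup {n : ℕ} (φ : HochCochain k (MonoidAlgebra k G) n) (g : Fin n → G) :
    MonoidAlgebra k G :=
  φ fun j => MonoidAlgebra.of k G (g j)

/-- A Hochschild cochain is determined by its values on tuples of group elements. -/
theorem onGroup_injective {n : ℕ} :
    Function.Injective (onGroup : HochCochain k (MonoidAlgebra k G) n → _) := by
  intro φ ψ h
  refine Module.Basis.ext_multilinear (fun _ => MonoidAlgebra.basis G k) fun v => ?_
  simpa [onGroup] using congrFun h v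

/-- The multilinear extension of a function on tuples of group elements. -/
def extend [Finite G] {n : ℕ} (F : (Fin n → G) → MonoidAlgebra k G) :
    HochCochain k (MonoidAlgebra k G) n :=
  letI := Fintype.ofFinite G
  ∑ g : Fin n → G, ((MultilinearMap.mkPiAlgebra k (Fin n) k).compLinearMap fun i =>
    Finsupp.lapply (g i) ∘ₗ (MonoidAlgebra.coeffLinearEquiv k).toLinearMap).smulRight (F g)

theorem extend_apply [Fintype G] {n : ℕ} (F : (Fin n → G) → MonoidAlgebra k G)
    (a : Fin n → MonoidAlgebra k G) :
    extend F a = ∑ g : Fin n → G, (∏ i, (a i).coeff (g i)) • F g := by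
  rw [extend, sum_apply, Subsingleton.elim (Fintype.ofFinite G) ‹_›]
  rfl

@[simp]
theorem onGroup_extend [Finite G] {n : ℕ} (F : (Fin n → G) → MonoidAlgebra k G) :
    onGroup (extend F) = F := by
  classical
  cases nonempty_fintype G
  ext1 g
  rw [onGroup, extend_apply, Finset.sum_eq_single g]
  · simp
  · intro g' _ h
    obtain ⟨i, hi⟩ := Function.ne_iff.1 h
    rw [Finset.prod_eq_zero (Finset.mem_univ i), zero_smul]
    simp [hi.symm]
  · simp

/-- The unit of `kG` is a basis element, so in the multilinear expansion an argument `1` leaves only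
tuples with entry `1` there. -/
theorem mem_hochNormalized_iff [Finite G] {n : ℕ} (φ : HochCochain k (MonoidAlgebra k G) n) :
    φ ∈ hochNormalized k (MonoidAlgebra k G) n ↔
      ∀ g : Fin n → G, (∃ i, g i = 1) → onGroup φ g = 0 := by
  classical
  cases nonempty_fintype G
  refine ⟨fun h g ⟨i, hi⟩ => h _ ⟨i, by simp [hi, MonoidAlgebra.one_def]⟩, fun h a ⟨i, hi⟩ => ?_⟩
  have hφ : φ = extend (onGroup φ) := onGroup_injective (onGroup_extend _).symm
  rw [hφ, extend_apply]
  refine Finset.sum_eq_zero fun g _ => ?_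
  by_cases hg : g i = 1
  · rw [h g ⟨i, hg⟩, smul_zero]
  · rw [Finset.prod_eq_zero (Finset.mem_univ i), zero_smul]
    simp [hi, MonoidAlgebra.one_def, Ne.symm hg]

theorem onGroup_hochDifferential {n : ℕ} (φ : HochCochain k (MonoidAlgebra k G) n)
    (g : Fin (n + 1) → G) :
    onGroup (hochDifferential k (MonoidAlgebra k G) n φ) g =
      MonoidAlgebra.of k G (g 0) * onGroup φ (Fin.tail g) +
      ∑ i : Fin n, (-1 : k) ^ (i.val + 1) •
        onGroup φ (Fin.contractNth i.castSucc (· * ·) g) +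
      (-1 : k) ^ (n + 1) • (onGroup φ (Fin.init g) * MonoidAlgebra.of k G (g (Fin.last n))) := by
  rw [onGroup, hochDifferential_apply]
  congr 2
  refine Finset.sum_congr rfl fun i _ => ?_
  rw [onGroup]
  congr 2
  ext1 j
  simp only [Fin.contractNth]
  split_ifs <;> simp

/-! ### Coefficients as functions of vertices. -/

/-- The coefficient of `w₀⁻¹xwₙ` in `φ(w₀⁻¹w₁, …, wₙ₋₁⁻¹wₙ)`. -/
def cyclicCoeff {n : ℕ} (φ : HochCochain k (MonoidAlgebra k G) n) (x : G) (w : ℕ → G) : k :=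
  (onGroup φ (quotients n w)).coeff ((w 0)⁻¹ * x * w n)

theorem cyclicCoeff_congr {n : ℕ} (φ : HochCochain k (MonoidAlgebra k G) n) (x : G)
    {v w : ℕ → G} (h : ∀ l ≤ n, v l = w l) : cyclicCoeff φ x v = cyclicCoeff φ x w := by
  rw [cyclicCoeff, cyclicCoeff, quotients_congr h, h 0 (by omega), h n le_rfl]

/-- The outer factors `w₀⁻¹w₁` and `wₙ⁻¹wₙ₊₁` shift the index `w₀⁻¹xwₙ₊₁` to `w₁⁻¹xwₙ₊₁` and
`w₀⁻¹xwₙ`, which are the indices of the outer faces. -/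
theorem cyclicCoeff_hochDifferential {n : ℕ} (φ : HochCochain k (MonoidAlgebra k G) n) (x : G)
    (w : ℕ → G) :
    cyclicCoeff (hochDifferential k (MonoidAlgebra k G) n φ) x w =
      ∑ i ∈ Finset.range (n + 2), (-1 : k) ^ i * cyclicCoeff φ x (face i w) := by
  rw [sum_range_faces, cyclicCoeff, onGroup_hochDifferential]
  simp only [MonoidAlgebra.coeff_add, MonoidAlgebra.coeff_sum, MonoidAlgebra.coeff_smul,
    Finsupp.add_apply, Finsupp.finsetSum_apply, Finsupp.smul_apply, smul_eq_mul,
    MonoidAlgebra.of_apply, MonoidAlgebra.coeff_mul_single_apply,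
    MonoidAlgebra.coeff_single_mul_apply, one_mul, mul_one, cyclicCoeff, quotients_face_zero,
    quotients_face_succ, quotients_face_last, pow_zero]
  congr 3
  · simp [quotients, face, mul_assoc]
  · ext i
    simp [face, show ¬ n ≤ i.val by omega]
  · simp [quotients, face, mul_assoc]

/-- Since `w₀⁻¹xwₙ = (w₀⁻¹xw₀)g₁⋯gₙ`, the representative has to be that of the class of
`z(g₁⋯gₙ)⁻¹`. -/
theorem exists_cyclicCoeff_eq {X : Finset G} (hX : ∀ g : G, ∃! x : G, x ∈ X ∧ IsConj x g) {n : ℕ}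
    (g : Fin n → G) (z : G) :
    ∃ (x : X) (w : ℕ → G), quotients n w = g ∧ (w 0)⁻¹ * x * w n = z := by
  obtain ⟨x, ⟨hx, hc⟩, -⟩ := hX (z * (tupleProd g)⁻¹)
  obtain ⟨c, hc⟩ := isConj_iff.1 hc
  refine ⟨⟨x, hx⟩, vertices c⁻¹ g, quotients_vertices _ _, ?_⟩
  rw [vertices_zero, vertices_last, inv_inv, ← mul_assoc, hc, inv_mul_cancel_right]

theorem cyclicCoeff_ext {X : Finset G} (hX : ∀ g : G, ∃! x : G, x ∈ X ∧ IsConj x g) {n : ℕ}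
    {φ ψ : HochCochain k (MonoidAlgebra k G) n}
    (h : ∀ (x : X) (w : ℕ → G), cyclicCoeff φ (x : G) w = cyclicCoeff ψ (x : G) w) : φ = ψ := by
  refine onGroup_injective (funext fun g => MonoidAlgebra.ext (Finsupp.ext fun z => ?_))
  obtain ⟨x, w, rfl, rfl⟩ := exists_cyclicCoeff_eq hX g z
  exact h x w

/-! ### Reversed vertices and their sign. -/

/-- The sign `(-1)^(n(n+1)/2)`. -/
def reversalSign (k : Type*) [Field k] (n : ℕ) : k := (-1) ^ (n * (n + 1) / 2)

@[simp]
theorem reversalSign_mul_self (n : ℕ) : reversalSign k n * reversalSign k n = 1 := by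
  rw [reversalSign, ← mul_pow]
  simp

theorem reversalSign_succ (n : ℕ) :
    reversalSign k (n + 1) = reversalSign k n * (-1) ^ (n + 1) := by
  rw [reversalSign, reversalSign, ← pow_add]
  congr 1
  have h : (n + 1) * (n + 1 + 1) = n * (n + 1) + 2 * (n + 1) := by ring
  rw [h, Nat.add_mul_div_left _ _ two_pos]

/-- The coefficient of `v₀⁻¹xv₀` in `(-1)^(n(n+1)/2) g₁⋯gₙ φ(gₙ⁻¹, …, g₁⁻¹)`, where
`gᵢ = vᵢ₋₁⁻¹vᵢ`. -/
def vertexCoeff {n : ℕ} (φ : HochCochain k (MonoidAlgebra k G) n) (x : G) (v : ℕ → G) : k :=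
  reversalSign k n * cyclicCoeff φ x fun l => v (n - l)

theorem vertexCoeff_congr {n : ℕ} (φ : HochCochain k (MonoidAlgebra k G) n) (x : G)
    {v w : ℕ → G} (h : ∀ l ≤ n, v l = w l) : vertexCoeff φ x v = vertexCoeff φ x w := by
  rw [vertexCoeff, vertexCoeff, cyclicCoeff_congr]
  exact fun l _ => h _ (by omega)

theorem vertexCoeff_mul_left {n : ℕ} (φ : HochCochain k (MonoidAlgebra k G) n) {x z : G}
    (hz : z ∈ Subgroup.centralizer {x}) (v : ℕ → G) :
    vertexCoeff φ x (fun l => z * v l) = vertexCoeff φ x v := by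
  have hz' : z⁻¹ * x * z = x := by
    rw [mul_assoc, ← Subgroup.mem_centralizer_singleton_iff.1 hz, inv_mul_cancel_left]
  rw [vertexCoeff, vertexCoeff, cyclicCoeff, cyclicCoeff,
    quotients_mul_left n z fun l => v (n - l)]
  congr 2
  calc (z * v (n - 0))⁻¹ * x * (z * v (n - n)) =
      (v (n - 0))⁻¹ * (z⁻¹ * x * z) * v (n - n) := by group
    _ = _ := by rw [hz']

/-- The factor `g₁⋯gₙ = v₀⁻¹vₙ` moves the index `vₙ⁻¹xv₀` to a conjugate of `x`. -/
theorem vertexCoeff_eq {n : ℕ} (φ : HochCochain k (MonoidAlgebra k G) n) (x : G) (v : ℕ → G) :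
    vertexCoeff φ x v =
      (signedTranslate (quotients n v) (onGroup φ (revInv (quotients n v)))).coeff
        ((v 0)⁻¹ * x * v 0) := by
  simp [vertexCoeff, cyclicCoeff, quotients_reverse, signedTranslate, reversalSign,
    tupleProd_quotients, mul_assoc]

/-- Reversal exchanges the faces `i` and `n + 1 - i`, which costs a sign `(-1)^(n+1)`, the ratio of
consecutive reversal signs. -/
theorem vertexCoeff_hochDifferential {n : ℕ} (φ : HochCochain k (MonoidAlgebra k G) n) (x : G)
    (v : ℕ → G) :
    vertexCoeff (hochDifferential k (MonoidAlgebra k G) n φ) x v =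
      ∑ i ∈ Finset.range (n + 2), (-1 : k) ^ i * vertexCoeff φ x (face i v) := by
  rw [vertexCoeff, cyclicCoeff_hochDifferential, Finset.mul_sum, ← Finset.sum_range_reflect]
  refine Finset.sum_congr rfl fun i hi => ?_
  have hi : i ≤ n + 1 := Nat.lt_succ_iff.1 (Finset.mem_range.1 hi)
  rw [vertexCoeff, reversalSign_succ, show n + 2 - 1 - i = n + 1 - i by omega,
    cyclicCoeff_congr φ x (w := fun l => face i v (n - l)) fun l hl => by
      simp only [face]
      split_ifs
      all_goals first | (exfalso; omega) | (congr 1; omega)]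
  have hs : (-1 : k) ^ (n + 1) * (-1) ^ (n + 1 - i) = (-1) ^ i := by
    obtain ⟨j, hj⟩ := Nat.exists_eq_add_of_le hi
    rw [hj, Nat.add_sub_cancel_left, pow_add, mul_assoc, ← mul_pow]
    simp
  rw [← hs]
  ring

theorem vertexCoeff_ext {X : Finset G} (hX : ∀ g : G, ∃! x : G, x ∈ X ∧ IsConj x g) {n : ℕ}
    {φ ψ : HochCochain k (MonoidAlgebra k G) n}
    (h : ∀ (x : X) (v : ℕ → G), vertexCoeff φ (x : G) v = vertexCoeff ψ (x : G) v) : φ = ψ := by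
  refine cyclicCoeff_ext hX fun x w => ?_
  have hs : reversalSign k n ≠ 0 := left_ne_zero_of_mul_eq_one (reversalSign_mul_self n)
  have := mul_left_cancel₀ hs (h x fun l => w (n - l))
  rwa [cyclicCoeff_congr φ (x : G) (w := w), cyclicCoeff_congr ψ (x : G) (w := w)] at this
  all_goals
    intro l hl
    dsimp only
    rw [show n - (n - l) = l by omega]

theorem vertexCoeff_eq_zero [Finite G] {n : ℕ} {φ : HochCochain k (MonoidAlgebra k G) n}
    (hφ : φ ∈ hochNormalized k (MonoidAlgebra k G) n) (x : G) {v : ℕ → G} {l : ℕ} (hl : l < n)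
    (hv : v l = v (l + 1)) : vertexCoeff φ x v = 0 := by
  rw [vertexCoeff_eq, (mem_hochNormalized_iff φ).1 hφ]
  · simp [signedTranslate]
  · refine ⟨Fin.rev ⟨l, hl⟩, ?_⟩
    rw [revInv, Fin.rev_rev, (quotients_eq_one_iff v ⟨l, hl⟩).2 hv, inv_one]

theorem mem_hochNormalized_of_vertexCoeff [Finite G] {X : Finset G}
    (hX : ∀ g : G, ∃! x : G, x ∈ X ∧ IsConj x g) {n : ℕ}
    {φ : HochCochain k (MonoidAlgebra k G) n}
    (h : ∀ (x : X) (v : ℕ → G) (l : ℕ), l < n → v l = v (l + 1) →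
      vertexCoeff φ (x : G) v = 0) :
    φ ∈ hochNormalized k (MonoidAlgebra k G) n := by
  refine (mem_hochNormalized_iff φ).2 fun g ⟨i, hi⟩ =>
    MonoidAlgebra.ext (Finsupp.ext fun z => ?_)
  obtain ⟨x, w, rfl, rfl⟩ := exists_cyclicCoeff_eq hX g z
  have hs : reversalSign k n ≠ 0 := left_ne_zero_of_mul_eq_one (reversalSign_mul_self n)
  have h0 := h x (fun l => w (n - l)) i.rev i.rev.isLt (by
    rw [quotients_eq_one_iff] at hi
    simp only [Fin.val_rev]
    rw [show n - (n - (i + 1)) = i.val + 1 by omega, show n - (n - (i + 1) + 1) = i.val by omega,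
      hi])
  have h1 := (mul_eq_zero.1 h0).resolve_left hs
  rw [cyclicCoeff_congr φ (x : G) (w := w) fun l hl => by
    dsimp only
    rw [show n - (n - l) = l by omega]] at h1
  exact h1

/-- For `v 0` in the centralizer the conjugate `v₀⁻¹xv₀` is `x`, so `hat` is a restriction. -/
theorem hat_quotients {n : ℕ} (φ : HochCochain k (MonoidAlgebra k G) n) (x : G)
    (v : ℕ → Subgroup.centralizer {x}) :
    hat φ x (quotients n v) = vertexCoeff φ x fun l => v l := by
  have hx : ((v 0 : G))⁻¹ * x * v 0 = x := by
    rw [mul_assoc, ← Subgroup.mem_centralizer_singleton_iff.1 (v 0).2, inv_mul_cancel_left]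
  rw [vertexCoeff_eq, hx]
  rfl

end Hochschild

/-! ### From functions of vertices to Hochschild cochains -/

section Assemble

variable {k : Type*} [Field k] {G : Type*} [Group G]

theorem mem_centralizer_of_conj_eq {x a b : G} (h : a⁻¹ * x * a = b⁻¹ * x * b) :
    b * a⁻¹ ∈ Subgroup.centralizer {x} := by
  rw [Subgroup.mem_centralizer_singleton_iff]
  calc b * a⁻¹ * x = b * (a⁻¹ * x * a) * a⁻¹ := by group
    _ = x * (b * a⁻¹) := by rw [h]; group

/-- The two tuples have mutually inverse products and the sign squares to `1`, which is why both
formulas use the same twist. -/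
theorem signedTranslate_signedTranslate_revInv {n : ℕ} (v : ℕ → G) (m : MonoidAlgebra k G) :
    signedTranslate (quotients n v) (signedTranslate (revInv (quotients n v)) m) = m := by
  have hs : (-1 : k) ^ (n * (n + 1) / 2) * (-1) ^ (n * (n + 1) / 2) = 1 :=
    reversalSign_mul_self n
  rw [signedTranslate, signedTranslate, ← quotients_reverse, tupleProd_quotients,
    tupleProd_quotients, mul_smul_comm, smul_smul, hs, one_smul, ← mul_assoc, ← map_mul]
  simp [← MonoidAlgebra.one_def]

/-- The `C`-component of a group element, for a right transversal of `C`. -/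
def cosetProj {C : Subgroup G} {S : Finset G}
    (hS : Subgroup.IsComplement (C : Set G) (S : Set G)) (g : G) : C :=
  (hS.equiv g).1

theorem cosetProj_mul_left {C : Subgroup G} {S : Finset G}
    (hS : Subgroup.IsComplement (C : Set G) (S : Set G)) (z : C) (g : G) :
    cosetProj hS (z * g) = z * cosetProj hS g := by
  rw [cosetProj, hS.equiv_mul_left]
  rfl

theorem cosetProj_coe {C : Subgroup G} {S : Finset G}
    (hS : Subgroup.IsComplement (C : Set G) (S : Set G)) (h1 : 1 ∈ S) (z : C) :
    cosetProj hS (z : G) = z :=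
  hS.equiv_fst_eq_self_of_mem_of_one_mem h1 z.2

/-- Each step discards a left factor in `C`, which does not affect later components in `S`. -/
theorem cosetPath_eq {C : Subgroup G} {S : Finset G}
    (hS : Subgroup.IsComplement (C : Set G) (S : Set G)) (γ : (S : Set G)) {n : ℕ}
    (g : Fin n → G) (j : Fin (n + 1)) :
    cosetPath hS γ g j = (hS.equiv (vertices (γ : G) g j)).2 := by
  induction j using Fin.induction with
  | zero =>
    rw [Fin.val_zero, vertices_zero, hS.equiv_snd_eq_self_of_mem_of_one_mem C.one_mem γ.2]
    rfl
  | succ j ih =>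
    have h : cosetPath hS γ g j.succ = (hS.equiv ((cosetPath hS γ g j.castSucc : G) * g j)).2 :=
      rfl
    rw [h, ih, hS.equiv_snd_eq_inv_mul, Fin.val_castSucc, mul_assoc, ← vertices_succ,
      ← Subgroup.coe_inv, hS.equiv_mul_left]
    rfl

/-- This turns the recursion behind `unhat` into a pullback of vertices along `cosetProj`. -/
theorem cosetFactor_eq {C : Subgroup G} {S : Finset G}
    (hS : Subgroup.IsComplement (C : Set G) (S : Set G)) (γ : (S : Set G)) {n : ℕ}
    (g : Fin n → G) :
    cosetFactor hS γ g = quotients n fun l => cosetProj hS (vertices (γ : G) g l) := by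
  ext1 j
  rw [cosetFactor, cosetPath_eq, hS.equiv_snd_eq_inv_mul, Fin.val_castSucc, mul_assoc,
    ← vertices_succ, ← Subgroup.coe_inv, hS.equiv_mul_left]
  rfl

/-- The Hochschild cochain whose coefficients are given by functions of vertices that start in
the transversals. -/
def assemble [Finite G] {X : Finset G} (S : X → Finset G) (n : ℕ) (Ψ : X → (ℕ → G) → k) :
    HochCochain k (MonoidAlgebra k G) n :=
  extend fun g => signedTranslate g (∑ x : X, ∑ γ : (S x : Set G),
    Ψ x (vertices (γ : G) (revInv g)) • MonoidAlgebra.of k G ((γ : G)⁻¹ * (x : G) * (γ : G)))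

/-- The coefficient at `v₀⁻¹xv₀` selects one term of the double sum: the one for `x` and the
transversal element `γ₀` of the coset of `v 0`. Invariance under `v₀γ₀⁻¹`, which centralizes `x`,
then moves the start from `γ₀` to `v 0`. -/
theorem vertexCoeff_assemble [Finite G] {X : Finset G}
    (hX : ∀ g : G, ∃! x : G, x ∈ X ∧ IsConj x g) {S : X → Finset G}
    (hS : ∀ x : X, Subgroup.IsComplement
      (Subgroup.centralizer {(x : G)} : Set G) (S x : Set G))
    {n : ℕ} (Ψ : X → (ℕ → G) → k)
    (hΨ : ∀ x : X, ∀ z ∈ Subgroup.centralizer {(x : G)}, ∀ v, Ψ x (fun l => z * v l) = Ψ x v)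
    (hΨ' : ∀ x v w, (∀ l ≤ n, v l = w l) → Ψ x v = Ψ x w) (x : X) (v : ℕ → G) :
    vertexCoeff (assemble S n Ψ) (x : G) v = Ψ x v := by
  classical
  rw [vertexCoeff_eq, assemble, onGroup_extend, signedTranslate_signedTranslate_revInv,
    ← quotients_reverse, revInv_quotients]
  simp only [MonoidAlgebra.coeff_sum, MonoidAlgebra.coeff_smul, Finsupp.finsetSum_apply,
    Finsupp.smul_apply, MonoidAlgebra.of_apply, MonoidAlgebra.coeff_single, smul_eq_mul]
  set γ₀ : (S x : Set G) := ((hS x).equiv (v 0)).2 with hγ₀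
  have hv0 : v 0 * (γ₀ : G)⁻¹ = ((hS x).equiv (v 0)).1 :=
    ((hS x).equiv_fst_eq_mul_inv (v 0)).symm
  rw [Finset.sum_eq_single x, Finset.sum_eq_single γ₀]
  · have hc : (γ₀ : G)⁻¹ * x * γ₀ = (v 0)⁻¹ * x * v 0 := by
      have h : v 0 * (γ₀ : G)⁻¹ ∈ Subgroup.centralizer {(x : G)} := hv0 ▸ Subtype.coe_prop _
      have h' := Subgroup.mem_centralizer_singleton_iff.1 h
      calc (γ₀ : G)⁻¹ * x * γ₀ = (v 0)⁻¹ * (v 0 * (γ₀ : G)⁻¹ * x) * γ₀ := by group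
        _ = _ := by rw [h']; group
    rw [hc, Finsupp.single_eq_same, mul_one, ← hΨ x (v 0 * (γ₀ : G)⁻¹) (hv0 ▸ Subtype.coe_prop _)]
    exact hΨ' _ _ _ fun l hl => (eq_mul_vertices_quotients v _ hl).symm
  -- Equal conjugates put `γ` into the coset of `v 0`, and a coset contains only one element of the
  -- transversal.
  · intro γ _ hne
    rw [Finsupp.single_eq_of_ne, mul_zero]
    intro h
    refine hne ?_
    have hz := mem_centralizer_of_conj_eq h
    have hz' : (γ : G) * (v 0)⁻¹ * v 0 = γ := by group
    have h1 := congrArg Prod.snd ((hS x).equiv_mul_left ⟨_, hz⟩ (v 0))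
    change ((hS x).equiv ((γ : G) * (v 0)⁻¹ * v 0)).2 = γ₀ at h1
    rw [hz', (hS x).equiv_snd_eq_self_of_mem_of_one_mem (Subgroup.one_mem _) γ.2] at h1
    exact h1
  · simp
  · intro y _ hne
    refine Finset.sum_eq_zero fun γ _ => ?_
    rw [Finsupp.single_eq_of_ne, mul_zero]
    intro h
    refine hne (Subtype.ext ((hX (x : G)).unique ⟨y.2, ?_⟩ ⟨x.2, IsConj.refl _⟩))
    refine isConj_iff.2 ⟨v 0 * (γ : G)⁻¹, ?_⟩
    calc v 0 * (γ : G)⁻¹ * y * (v 0 * (γ : G)⁻¹)⁻¹ =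
        v 0 * ((γ : G)⁻¹ * y * γ) * (v 0)⁻¹ := by group
      _ = x := by rw [← h]; group
  · simp

/-- The Hochschild cochain with values `unhat`. -/
def unhatCochain [Finite G] {X : Finset G} {S : X → Finset G}
    (hS : ∀ x : X, Subgroup.IsComplement
      (Subgroup.centralizer {(x : G)} : Set G) (S x : Set G))
    {n : ℕ} (f : ∀ x : X, (Fin n → Subgroup.centralizer {(x : G)}) → k) :
    HochCochain k (MonoidAlgebra k G) n :=
  extend (unhat hS f)

theorem vertexCoeff_unhatCochain [Finite G] {X : Finset G}
    (hX : ∀ g : G, ∃! x : G, x ∈ X ∧ IsConj x g) {S : X → Finset G}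
    (hS : ∀ x : X, Subgroup.IsComplement
      (Subgroup.centralizer {(x : G)} : Set G) (S x : Set G))
    {n : ℕ} (f : ∀ x : X, (Fin n → Subgroup.centralizer {(x : G)}) → k) (x : X) (v : ℕ → G) :
    vertexCoeff (unhatCochain hS f) (x : G) v =
      f x (quotients n fun l => cosetProj (hS x) (v l)) := by
  have h : unhatCochain hS f =
      assemble S n fun x v => f x (quotients n fun l => cosetProj (hS x) (v l)) := by
    refine congrArg extend (funext fun g => ?_)
    rw [unhat]
    simp_rw [cosetFactor_eq]
  rw [h, vertexCoeff_assemble hX hS]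
  · intro x z hz v
    congr 1
    exact (congrArg (quotients n) (funext fun l => cosetProj_mul_left (hS x) ⟨z, hz⟩ (v l))).trans
      (quotients_mul_left _ _ _)
  · intro x v w h
    rw [quotients_congr fun l hl => by rw [h l hl]]

end Assemble

/-! ### The homotopy -/

section Homotopy

variable {k : Type*} [Field k] {G : Type*} [Group G]

theorem sum_vertexCoeff_prism {n : ℕ} {φ : HochCochain k (MonoidAlgebra k G) n}
    (hφ : hochDifferential k (MonoidAlgebra k G) n φ = 0) (x : G) (c : G → G) (v : ℕ → G) :
    ∑ j ∈ Finset.range n, ∑ i ∈ Finset.range (n + 1),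
      (-1 : k) ^ (j + i) * vertexCoeff φ x (prism c j (face i v)) =
    vertexCoeff φ x v - vertexCoeff φ x fun l => c (v l) := by
  have h := prism_sum n (fun j i => vertexCoeff φ x (face i (prism c j v)))
    (fun j i => vertexCoeff φ x (prism c j (face i v)))
    (fun j => vertexCoeff φ x fun l => if l < j then c (v l) else v l)
    (fun j i hij => by rw [face_prism_of_le c v hij])
    (fun j i hij => by rw [face_prism_of_lt c v hij])
    (fun j => by rw [face_prism_self]) (fun j => by rw [face_prism_succ])
  -- For each `j` the sum over `i` is, up to sign, a value of the differential of `φ`.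
  have h0 : ∑ j ∈ Finset.range (n + 1), ∑ i ∈ Finset.range (n + 2),
      (-1 : k) ^ (j + i) * vertexCoeff φ x (face i (prism c j v)) = 0 := by
    refine Finset.sum_eq_zero fun j _ => ?_
    have := vertexCoeff_hochDifferential φ x (prism c j v)
    simp only [pow_add, mul_assoc]
    rw [← Finset.mul_sum, ← this, hφ]
    simp [vertexCoeff, cyclicCoeff, onGroup]
  rw [h0] at h
  rw [eq_comm, sub_eq_zero] at h
  rw [← h]
  congr 1
  refine vertexCoeff_congr _ _ fun l hl => ?_
  rw [if_pos (by omega)]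

/-- A Hochschild cocycle is a coboundary if all its components are. -/
theorem mem_coboundaries_of_hat [Finite G] {X : Finset G}
    (hX : ∀ g : G, ∃! x : G, x ∈ X ∧ IsConj x g) {S : X → Finset G}
    (hS : ∀ x : X, Subgroup.IsComplement
      (Subgroup.centralizer {(x : G)} : Set G) (S x : Set G))
    {n : ℕ} {φ : HochCochain k (MonoidAlgebra k G) n}
    (hφ : φ ∈ HochCocycles k (MonoidAlgebra k G) n)
    (h : ∀ x : X, hat φ (x : G) ∈
      coboundaries (grpNormalized k (Subgroup.centralizer {(x : G)}) k)
        (grpDifferential (Representation.trivial k (Subgroup.centralizer {(x : G)}) k)) n) :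
    φ ∈ coboundaries (hochNormalized k (MonoidAlgebra k G))
      (hochDifferential k (MonoidAlgebra k G)) n := by
  have hδ : hochDifferential k (MonoidAlgebra k G) n φ = 0 := hφ.2
  have key := fun (x : X) => sum_vertexCoeff_prism hδ (x : G) fun g => (cosetProj (hS x) g : G)
  cases n with
  | zero =>
    -- In degree zero the homotopy is an empty sum, so `φ` is the pullback of its restriction, which
    -- is zero.
    refine (Submodule.mem_bot k).2 (vertexCoeff_ext hX fun x v => ?_)
    have hx : hat φ (x : G) = 0 := h x
    have := key x v
    rw [Finset.range_zero, Finset.sum_empty, ← hat_quotients φ (x : G), hx, Pi.zero_apply,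
      sub_zero] at this
    rw [← this]
    simp [vertexCoeff, cyclicCoeff, onGroup]
  | succ n =>
    choose b hb hbδ using fun x => Submodule.mem_map.1 (h x)
    -- The primitive of `φ`: the differential of the pulled back `b x` is `φ` at the projected
    -- vertices, and that of the prism term is the difference between `φ` at `v` and there.
    let Ψ (x : X) (v : ℕ → G) : k := b x (quotients n fun l => cosetProj (hS x) (v l)) +
      ∑ j ∈ Finset.range (n + 1), (-1) ^ j *
        vertexCoeff φ (x : G) (prism (fun g => (cosetProj (hS x) g : G)) j v)
    have hΨ : ∀ (x : X) (v : ℕ → G), vertexCoeff (assemble S n Ψ) (x : G) v = Ψ x v := by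
      refine vertexCoeff_assemble hX hS Ψ (fun x z hz v => ?_) (fun x v w hvw => ?_)
      · have hc : ∀ g, cosetProj (hS x) (z * g) = ⟨z, hz⟩ * cosetProj (hS x) g :=
          fun g => cosetProj_mul_left (hS x) ⟨z, hz⟩ g
        simp only [Ψ, hc]
        congr 1
        · exact congrArg (b x) (quotients_mul_left _ _ _)
        · refine Finset.sum_congr rfl fun j _ => ?_
          refine congrArg _ (Eq.trans ?_ (vertexCoeff_mul_left φ hz _))
          congr 1
          ext1 l
          simp only [prism, hc]
          split_ifs <;> rfl
      · simp only [Ψ]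
        rw [quotients_congr fun l hl => by rw [hvw l hl]]
        congr 1
        refine Finset.sum_congr rfl fun j hj => ?_
        have hj := Finset.mem_range.1 hj
        rw [vertexCoeff_congr φ (x : G) fun l hl => ?_]
        simp only [prism]
        split_ifs
        · rw [hvw l (by omega)]
        · rw [hvw (l - 1) (by omega)]
    refine Submodule.mem_map.2 ⟨assemble S n Ψ, ?_, ?_⟩
    · refine mem_hochNormalized_of_vertexCoeff hX fun x v l hl hv => ?_
      rw [hΨ]
      simp only [Ψ]
      rw [hb x _ ⟨⟨l, hl⟩, (quotients_eq_one_iff _ _).2 (by simp only [hv])⟩, zero_add]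
      refine Finset.sum_eq_zero fun j _ => ?_
      -- A repeated vertex survives in the prism simplex: at position `l` inside the projected part,
      -- otherwise at `l + 1`.
      by_cases hlj : l + 1 ≤ j
      · rw [vertexCoeff_eq_zero hφ.1 (x : G) (l := l) (by omega), mul_zero]
        simp [prism, hlj, show l ≤ j by omega, hv]
      · rw [vertexCoeff_eq_zero hφ.1 (x : G) (l := l + 1) (by omega), mul_zero]
        simp [prism, hlj, show ¬ l + 1 + 1 ≤ j by omega, hv]
    · refine vertexCoeff_ext hX fun x v => ?_
      rw [vertexCoeff_hochDifferential]
      simp only [hΨ, Ψ, mul_add, Finset.sum_add_distrib, Finset.mul_sum]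
      rw [Finset.sum_comm]
      have hbx := grpDifferential_trivial_quotients (b x) fun l => cosetProj (hS x) (v l)
      rw [hbδ, hat_quotients φ (x : G)] at hbx
      have hbx' : ∑ i ∈ Finset.range (n + 2), (-1 : k) ^ i *
          b x (quotients n fun l => cosetProj (hS x) (face i v l)) =
          vertexCoeff φ (x : G) fun l => cosetProj (hS x) (v l) := by
        rw [hbx]
        refine Finset.sum_congr rfl fun i _ => ?_
        congr 3
        ext1 l
        simp only [face]
        split_ifs <;> rfl
      rw [hbx', eq_comm, ← sub_eq_iff_eq_add', ← key x v]
      refine Finset.sum_congr rfl fun j _ => Finset.sum_congr rfl fun i _ => ?_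
      ring

end Homotopy

/-! ### The induced map on cohomology -/

section Comparison

variable {k : Type*} [Field k] {G : Type*} [Group G]

variable (k) in
/-- `hat` as a linear map. -/
def hatLinear (n : ℕ) (x : G) :
    HochCochain k (MonoidAlgebra k G) n →ₗ[k] ((Fin n → Subgroup.centralizer {x}) → k) where
  toFun φ := hat φ x
  map_add' φ ψ := by
    ext h
    simp [hat, signedTranslate, mul_add]
  map_smul' c φ := by
    ext h
    simp [hat, signedTranslate, mul_left_comm]

/-- Both differentials are alternating sums over faces, and faces of vertices in the centralizer
stay there. -/
theorem hat_hochDifferential {n : ℕ} (φ : HochCochain k (MonoidAlgebra k G) n) (x : G) :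
    hat (hochDifferential k (MonoidAlgebra k G) n φ) x =
      grpDifferential (Representation.trivial k (Subgroup.centralizer {x}) k) n (hat φ x) := by
  ext1 h
  rw [← quotients_vertices 1 h, hat_quotients, vertexCoeff_hochDifferential,
    grpDifferential_trivial_quotients]
  refine Finset.sum_congr rfl fun i _ => ?_
  rw [hat_quotients]
  congr 2
  ext1 l
  simp only [face]
  split_ifs <;> rfl

theorem GrpCohomology.mk_eq_zero_iff {H : Type*} [Group H] {n : ℕ} (f : GrpCocycles k H n) :
    GrpCohomology.mk f = 0 ↔
      f.1 ∈ coboundaries (grpNormalized k H k)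
        (grpDifferential (Representation.trivial k H k)) n :=
  Submodule.Quotient.mk_eq_zero _

variable [Finite G]

theorem hat_mem_grpNormalized {n : ℕ} {φ : HochCochain k (MonoidAlgebra k G) n}
    (hφ : φ ∈ hochNormalized k (MonoidAlgebra k G) n) (x : G) :
    hat φ x ∈ grpNormalized k (Subgroup.centralizer {x}) k n := by
  rintro h ⟨i, hi⟩
  rw [← quotients_vertices 1 h, quotients_eq_one_iff] at hi
  rw [← quotients_vertices 1 h, hat_quotients]
  exact vertexCoeff_eq_zero hφ x i.isLt (congrArg Subtype.val hi)

theorem hat_mem_grpCocycles {n : ℕ} {φ : HochCochain k (MonoidAlgebra k G) n}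
    (hφ : φ ∈ HochCocycles k (MonoidAlgebra k G) n) (x : G) :
    hat φ x ∈ GrpCocycles k (Subgroup.centralizer {x}) n := by
  refine ⟨hat_mem_grpNormalized hφ.1 x, ?_⟩
  refine LinearMap.mem_ker.2 ?_
  rw [← hat_hochDifferential, LinearMap.mem_ker.1 hφ.2]
  exact (hatLinear k (n + 1) x).map_zero

theorem hat_mem_coboundaries {n : ℕ} {φ : HochCochain k (MonoidAlgebra k G) n}
    (hφ : φ ∈ coboundaries (hochNormalized k (MonoidAlgebra k G))
      (hochDifferential k (MonoidAlgebra k G)) n) (x : G) :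
    hat φ x ∈ coboundaries (grpNormalized k (Subgroup.centralizer {x}) k)
      (grpDifferential (Representation.trivial k (Subgroup.centralizer {x}) k)) n := by
  cases n with
  | zero =>
    rw [(Submodule.mem_bot k).1 hφ]
    exact (hatLinear k 0 x).map_zero
  | succ n =>
    obtain ⟨ψ, hψ, rfl⟩ := Submodule.mem_map.1 hφ
    exact Submodule.mem_map.2 ⟨hat ψ x, hat_mem_grpNormalized hψ x, (hat_hochDifferential ψ x).symm⟩

variable {X : Finset G} (hX : ∀ g : G, ∃! x : G, x ∈ X ∧ IsConj x g) {S : X → Finset G}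
  (hS : ∀ x : X, Subgroup.IsComplement
    (Subgroup.centralizer {(x : G)} : Set G) (S x : Set G))

include hX in
theorem unhatCochain_mem_hochCocycles {n : ℕ}
    (f : ∀ x : X, GrpCocycles k (Subgroup.centralizer {(x : G)}) n) :
    unhatCochain hS (fun x => (f x).1) ∈ HochCocycles k (MonoidAlgebra k G) n := by
  refine ⟨mem_hochNormalized_of_vertexCoeff hX fun x v l hl hv => ?_,
    LinearMap.mem_ker.2 (vertexCoeff_ext hX fun x v => ?_)⟩
  · rw [vertexCoeff_unhatCochain hX]
    exact (f x).2.1 _ ⟨⟨l, hl⟩, (quotients_eq_one_iff _ _).2 (by simp only [hv])⟩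
  · have h := grpDifferential_trivial_quotients (f x).1 fun l => cosetProj (hS x) (v l)
    rw [LinearMap.mem_ker.1 (f x).2.2] at h
    rw [vertexCoeff_hochDifferential]
    simp only [vertexCoeff_unhatCochain hX]
    refine Eq.trans ?_ (h.symm.trans ?_)
    · refine Finset.sum_congr rfl fun i _ => ?_
      refine congrArg (fun w => (-1) ^ i * (f x).1 (quotients n w)) (funext fun l => ?_)
      simp only [face]
      split_ifs <;> rfl
    · simp [vertexCoeff, cyclicCoeff, onGroup]

include hX in
-- Restricting a pullback along a retraction gives back the function; `1 ∈ S x` makes `cosetProj` a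
-- retraction.
theorem hat_unhatCochain (hS1 : ∀ x : X, (1 : G) ∈ S x) {n : ℕ}
    (f : ∀ x : X, (Fin n → Subgroup.centralizer {(x : G)}) → k) (x : X) :
    hat (unhatCochain hS f) (x : G) = f x := by
  ext1 h
  rw [← quotients_vertices 1 h, hat_quotients, vertexCoeff_unhatCochain hX]
  simp only [cosetProj_coe (hS x) (hS1 x)]

variable (k X) in
/-- The map that sends a Hochschild cocycle to the classes of its components. -/
def hatClass (n : ℕ) : HochCocycles k (MonoidAlgebra k G) n →ₗ[k]
    ∀ x : X, GrpCohomology k (Subgroup.centralizer {(x : G)}) n :=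
  LinearMap.pi fun x => Submodule.mkQ _ ∘ₗ
    (hatLinear k n (x : G)).restrict fun _ hφ => hat_mem_grpCocycles hφ (x : G)

theorem hatClass_apply {n : ℕ} (φ : HochCocycles k (MonoidAlgebra k G) n) (x : X) :
    hatClass k X n φ x = GrpCohomology.mk ⟨hat φ.1 (x : G), hat_mem_grpCocycles φ.2 (x : G)⟩ :=
  rfl

include hX hS in
theorem ker_hatClass (n : ℕ) :
    LinearMap.ker (hatClass k X n) =
      (coboundaries (hochNormalized k (MonoidAlgebra k G))
        (hochDifferential k (MonoidAlgebra k G)) n).submoduleOf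
          (HochCocycles k (MonoidAlgebra k G) n) := by
  ext φ
  rw [LinearMap.mem_ker, Submodule.submoduleOf, Submodule.mem_comap, funext_iff]
  simp only [hatClass_apply, Pi.zero_apply, GrpCohomology.mk_eq_zero_iff,
    Submodule.subtype_apply]
  exact ⟨mem_coboundaries_of_hat hX hS φ.2, fun h x => hat_mem_coboundaries h (x : G)⟩

/-- The Hochschild cocycle with values `unhat`. -/
def unhatCocycle {n : ℕ} (f : ∀ x : X, GrpCocycles k (Subgroup.centralizer {(x : G)}) n) :
    HochCocycles k (MonoidAlgebra k G) n :=
  ⟨unhatCochain hS fun x => (f x).1, unhatCochain_mem_hochCocycles hX hS f⟩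

theorem hatClass_unhatCocycle (hS1 : ∀ x : X, (1 : G) ∈ S x) {n : ℕ}
    (f : ∀ x : X, GrpCocycles k (Subgroup.centralizer {(x : G)}) n) :
    hatClass k X n (unhatCocycle hX hS f) = fun x => GrpCohomology.mk (f x) := by
  ext1 x
  rw [hatClass_apply]
  exact congrArg GrpCohomology.mk (Subtype.ext (hat_unhatCochain hX hS hS1 _ x))

include hX hS in
theorem hatClass_surjective (hS1 : ∀ x : X, (1 : G) ∈ S x) (n : ℕ) :
    Function.Surjective (hatClass k X n) := by
  intro y
  choose f hf using fun x => Submodule.Quotient.mk_surjective _ (y x)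
  exact ⟨unhatCocycle hX hS f, (hatClass_unhatCocycle hX hS hS1 f).trans (funext hf)⟩

/-- Hochschild cohomology of the group algebra as a product over the conjugacy classes. -/
def hochEquivPi (hS1 : ∀ x : X, (1 : G) ∈ S x) (n : ℕ) :
    HH k (MonoidAlgebra k G) n ≃ₗ[k]
      ∀ x : X, GrpCohomology k (Subgroup.centralizer {(x : G)}) n :=
  (Submodule.quotEquivOfEq _ _ (ker_hatClass hX hS n).symm).trans
    ((hatClass k X n).quotKerEquivOfSurjective (hatClass_surjective hX hS hS1 n))

theorem hochEquivPi_mk (hS1 : ∀ x : X, (1 : G) ∈ S x) {n : ℕ}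
    (φ : HochCocycles k (MonoidAlgebra k G) n) :
    hochEquivPi hX hS hS1 n (HH.mk φ) = hatClass k X n φ :=
  rfl

end Comparison

end

end GroupHochschild

open GroupHochschild in
theorem mainTheorem1 {k : Type*} [Field k] {G : Type*} [Group G] [Finite G]
    (X : Finset G) [DecidableEq X] (hX : ∀ g : G, ∃! x : G, x ∈ X ∧ IsConj x g)
    (S : X → Finset G)
    (hS : ∀ x : X, Subgroup.IsComplement
      (Subgroup.centralizer {(x : G)} : Set G) (S x : Set G))
    (hS1 : ∀ x : X, (1 : G) ∈ S x) :
    ∃ e : ∀ n : ℕ, HH k (MonoidAlgebra k G) n ≃ₗ[k]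
        ⨁ x : X, GrpCohomology k (Subgroup.centralizer {(x : G)}) n,
      (∀ (n : ℕ) (φ : HochCocycles k (MonoidAlgebra k G) n),
        ∃ f : ∀ x : X, GrpCocycles k (Subgroup.centralizer {(x : G)}) n,
          (∀ x : X, (f x).1 = hat φ.1 (x : G)) ∧
          ∀ x : X, e n (HH.mk φ) x = GrpCohomology.mk (f x)) ∧
      (∀ (n : ℕ) (f : ∀ x : X, GrpCocycles k (Subgroup.centralizer {(x : G)}) n),
        ∃ φ : HochCocycles k (MonoidAlgebra k G) n,
          (∀ g : Fin n → G,
            φ.1 (fun j => MonoidAlgebra.of k G (g j)) = unhat hS (fun x => (f x).1) g) ∧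
          (e n).symm (DirectSum.mk _ Finset.univ fun x => GrpCohomology.mk (f x)) =
            HH.mk φ) := by
  refine ⟨fun n => (hochEquivPi hX hS hS1 n).trans
    (DirectSum.linearEquivFunOnFintype k X _).symm, fun n φ => ?_, fun n f => ?_⟩
  · exact ⟨fun x => ⟨hat φ.1 (x : G), hat_mem_grpCocycles φ.2 (x : G)⟩, fun _ => rfl,
      fun _ => rfl⟩
  · refine ⟨unhatCocycle hX hS f, fun g => congrFun (onGroup_extend _) g, ?_⟩
    -- The inverse formula only needs `hat` after `unhat`, since the map is already known to be
    -- bijective.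
    rw [LinearEquiv.symm_apply_eq, LinearEquiv.trans_apply, hochEquivPi_mk,
      hatClass_unhatCocycle hX hS hS1, LinearEquiv.eq_symm_apply]
    ext1 x
    exact DirectSum.mk_apply_of_mem
      (β := fun x : X => GrpCohomology k (Subgroup.centralizer {(x : G)}) n)
      (f := fun x => GrpCohomology.mk (f x)) (Finset.mem_univ x)
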